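/- Topological spaces are non-empty. Let $\mathsf K$ be a class of topological spaces that is definable by a set of $\mathcal L_t$-sentences. Then $\mathsf K$ is definable by a set of $\mathcal H(@)$-formulas if and only if $\mathsf K$ is closed under topological ultrafilter morphic images (u-morphic images) and under taking non-empty open subspaces. Here the notions are as follows. **$\mathcal L_t$.** The two-sorted language $\mathcal L^2$ (without unary predicates, since we speak of spaces) has point variables $x,y,\dots$ and open variables $U,V,\dots$ (countably many of each) and the formulas $$\phi ::= \top \mid x=y \mid U=V \mid x\,\varepsilon\, U \mid \neg\phi \mid \phi\wedge\phi \mid \exists x.\phi \mid \exists U.\phi ,$$ where $\phi\to\psi$ abbreviates $\neg(\phi\wedge\neg\psi)$ and $\forall$ abbreviates $\neg\exists\neg$. In a space, point variables range over the points, open variables over the open sets, and $\varepsilon$ is membership. A formula $\alpha$ is positive (negative) in $U$ if every free occurrence of $U$ in $\alpha$ is in an atom $x\,\varepsilon\, U$ that stands under an even (odd) number of negation signs; in particular $U$ then has no free occurrence in an equality between open variables. $\mathcal L_t$ is the least set of $\mathcal L^2$-formulas that contains the atomic formulas and is closed under $\neg$, $\wedge$, $\exists x$, under $\alpha\mapsto\forall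 U.(x\,\varepsilon\, U\to\alpha)$ for $\alpha$ positive in $U$, and under $\alpha\mapsto\exists U.(x\,\varepsilon\, U\wedge\alpha)$ for $\alpha$ negative in $U$. A sentence is a formula without free variables. A set $T$ of sentences defines $\mathsf K$ if, for every space $X$, $X\in\mathsf K$ iff every sentence of $T$ is true in $X$. **$\mathcal H(@)$.** Its formulas are $$\phi ::= \top\mid p\mid i\mid \phi\wedge\phi\mid\neg\phi\mid\Box\phi\mid @_i\phi ,$$ with $p$ from a countably infinite set of propositional letters and $i$ from a disjoint countably infinite set of nominals. A valuation on a space $X$ assigns to each propositional letter a subset of $X$ and to each nominal a singleton subset of $X$. Truth at a point $w$ is defined as usual for letters, nominals and Boolean connectives; $\Box\phi$ is true at $w$ if $\phi$ is true throughout some open neighbourhood of $w$; and $@_i\phi$ is true at $w$ if $\phi$ is true at the point denoted by $i$. A formula is valid in $X$ if it is true at every point under every valuation. A set $\Gamma$ of formulas defines $\mathsf K$ if, for every space $X$, $X\in\mathsf K$ iff every formula of $\Gamma$ is valid in $X$. **u-morphic images.** A filter $\mathcal F$ over $X$ is open if $A\in\mathcal F$ implies that the interior of $A$ belongs to $\mathcal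 F$. The Alexandroff extension $X^*$ of $X$ is the set of ultrafilters over $X$ with the topology generated by the sets $\{\mathfrak u\mid\mathcal F\subseteq\mathfrak u\}$, for $\mathcal F$ an open filter over $X$. A space $Y$ is a u-morphic image of a space $X$ if there is a surjective continuous open map $f:X\to Y^*$ such that $|f^{-1}(\pi_y)|=1$ for every $y\in Y$, where $\pi_y$ is the principal ultrafilter of $y$. -/

import Mathlib

universe u v

namespace TopoModal

/-! ### The two-sorted topological language and its fragment `L_t` -/

/-- Formulas of the two-sorted language `L²` over a set `P` of unary predicate symbols.
Point variables and open variables are both named by natural numbers (in separate sorts). -/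
inductive L2Formula (P : Type v) : Type v where
  | verum : L2Formula P
  | eqPt (x y : ℕ) : L2Formula P
  | eqOp (U V : ℕ) : L2Formula P
  | pred (p : P) (x : ℕ) : L2Formula P
  | mem (x U : ℕ) : L2Formula P
  | neg (φ : L2Formula P) : L2Formula P
  | and (φ ψ : L2Formula P) : L2Formula P
  | exPt (x : ℕ) (φ : L2Formula P) : L2Formula P
  | exOp (U : ℕ) (φ : L2Formula P) : L2Formula P

namespace L2Formula

variable {P : Type v}

/-- `φ → ψ` abbreviates `¬ (φ ∧ ¬ ψ)`. -/
def imp (φ ψ : L2Formula P) : L2Formula P := neg (and φ (neg ψ))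

/-- `∀ U. φ` abbreviates `¬ ∃ U. ¬ φ`. -/
def allOp (U : ℕ) (φ : L2Formula P) : L2Formula P := neg (exOp U (neg φ))

/-- The point variables that occur free in a formula. -/
def freePt : L2Formula P → Set ℕ
  | verum => ∅
  | eqPt x y => {x, y}
  | eqOp _ _ => ∅
  | pred _ x => {x}
  | mem x _ => {x}
  | neg φ => freePt φ
  | and φ ψ => freePt φ ∪ freePt ψ
  | exPt x φ => freePt φ \ {x}
  | exOp _ φ => freePt φ

/-- The open variables that occur free in a formula. -/
def freeOp : L2Formula P → Set ℕ
  | verum => ∅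
  | eqPt _ _ => ∅
  | eqOp U V => {U, V}
  | pred _ _ => ∅
  | mem _ U => {U}
  | neg φ => freeOp φ
  | and φ ψ => freeOp φ ∪ freeOp ψ
  | exPt _ φ => freeOp φ
  | exOp U φ => freeOp φ \ {U}

/-- A sentence is a formula without free variables of either sort. -/
def IsSentence (φ : L2Formula P) : Prop := freePt φ = ∅ ∧ freeOp φ = ∅

/-- `HasPolarity U s φ`: every free occurrence of the open variable `U` in `φ` is in an atom
`x ε U` that is under an even (`s = true`), respectively odd (`s = false`), number of negation
signs. An equality between open variables has no polarity: `V = W` abbreviates the statement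
that `V` and `W` have the same elements, in which both variables occur with both signs. -/
def HasPolarity (U : ℕ) : Bool → L2Formula P → Prop
  | _, verum => True
  | _, eqPt _ _ => True
  | _, eqOp V W => V ≠ U ∧ W ≠ U
  | _, pred _ _ => True
  | s, mem _ V => V = U → s = true
  | s, neg φ => HasPolarity U (!s) φ
  | s, and φ ψ => HasPolarity U s φ ∧ HasPolarity U s ψ
  | s, exPt _ φ => HasPolarity U s φ
  | s, exOp V φ => V = U ∨ HasPolarity U s φ

/-- `φ` is positive in the open variable `U`. -/
def Positive (U : ℕ) (φ : L2Formula P) : Prop := HasPolarity U true φ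

/-- `φ` is negative in the open variable `U`. -/
def Negative (U : ℕ) (φ : L2Formula P) : Prop := HasPolarity U false φ

/-- Membership in the fragment `L_t` of `L²`: all atomic formulas, closed under negation,
conjunction, point quantification, and the two restricted open quantifications
`∀ U. (x ε U → α)` with `α` positive in `U`, and `∃ U. (x ε U ∧ α)` with `α` negative in `U`. -/
inductive IsLt : L2Formula P → Prop where
  | verum : IsLt verum
  | eqPt (x y : ℕ) : IsLt (eqPt x y)
  | eqOp (U V : ℕ) : IsLt (eqOp U V)
  | pred (p : P) (x : ℕ) : IsLt (pred p x)
  | mem (x U : ℕ) : IsLt (mem x U)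
  | neg {φ : L2Formula P} : IsLt φ → IsLt (neg φ)
  | and {φ ψ : L2Formula P} : IsLt φ → IsLt ψ → IsLt (and φ ψ)
  | exPt (x : ℕ) {φ : L2Formula P} : IsLt φ → IsLt (exPt x φ)
  | allNhd (x U : ℕ) {α : L2Formula P} :
      IsLt α → Positive U α → IsLt (allOp U (imp (mem x U) α))
  | exNhd (x U : ℕ) {α : L2Formula P} :
      IsLt α → Negative U α → IsLt (exOp U (and (mem x U) α))

/-- Truth of an `L²`-formula when point variables range over `X`, open variables range over the
family `σ` of subsets of `X`, the predicates are interpreted by `ν`, and `ε` is membership. -/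
def Sat {X : Type u} (σ : Set (Set X)) (ν : P → Set X) :
    (ℕ → X) → (ℕ → Set X) → L2Formula P → Prop
  | _, _, verum => True
  | g, _, eqPt x y => g x = g y
  | _, G, eqOp U V => G U = G V
  | g, _, pred p x => g x ∈ ν p
  | g, G, mem x U => g x ∈ G U
  | g, G, neg φ => ¬ Sat σ ν g G φ
  | g, G, and φ ψ => Sat σ ν g G φ ∧ Sat σ ν g G ψ
  | g, G, exPt x φ => ∃ d : X, Sat σ ν (Function.update g x d) G φ
  | g, G, exOp U φ => ∃ O ∈ σ, Sat σ ν g (Function.update G U O) φ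

/-- A topological space satisfies a formula without predicate symbols: the formula is true, with
open variables ranging over all open sets, under every assignment (for a sentence, the assignment
does not matter). -/
def TrueIn (X : Type u) [TopologicalSpace X] (φ : L2Formula Empty) : Prop :=
  ∀ (g : ℕ → X) (G : ℕ → Set X), (∀ U, IsOpen (G U)) →
    Sat {O : Set X | IsOpen O} (fun p => p.elim) g G φ

end L2Formula

/-! ### The hybrid language `H(@)` -/

/-- Formulas of the hybrid language `H(@)`, with countably many propositional letters `letter n`
and countably many nominals `nominal n`. -/
inductive HFormula : Type where
  | verum : HFormula
  | letter (p : ℕ) : HFormula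
  | nominal (i : ℕ) : HFormula
  | and (φ ψ : HFormula) : HFormula
  | neg (φ : HFormula) : HFormula
  | box (φ : HFormula) : HFormula
  | atNom (i : ℕ) (φ : HFormula) : HFormula

/-- A hybrid valuation: propositional letters denote subsets of `X`, and the nominal `i` denotes
the singleton `{nom i}`. -/
structure HValuation (X : Type u) where
  prop : ℕ → Set X
  nom : ℕ → X

namespace HFormula

/-- Truth of an `H(@)`-formula at a point of a hybrid topological model. -/
def Sat {X : Type u} [TopologicalSpace X] (ν : HValuation X) : X → HFormula → Prop
  | _, verum => True
  | w, letter p => w ∈ ν.prop p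
  | w, nominal i => w = ν.nom i
  | w, and φ ψ => Sat ν w φ ∧ Sat ν w ψ
  | w, neg φ => ¬ Sat ν w φ
  | w, box φ => ∃ O : Set X, IsOpen O ∧ w ∈ O ∧ ∀ v ∈ O, Sat ν v φ
  | _, atNom i φ => Sat ν (ν.nom i) φ

/-- Validity in a space: truth at every point under every hybrid valuation. -/
def Valid (X : Type u) [TopologicalSpace X] (φ : HFormula) : Prop :=
  ∀ (ν : HValuation X) (w : X), Sat ν w φ

end HFormula

/-! ### Alexandroff extensions and u-morphic images -/

/-- The points of the Alexandroff extension of `X` are the ultrafilters over `X`. (A separate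
name, because `Ultrafilter X` carries another topology in Mathlib.) -/
def AlexExt (X : Type u) : Type u := Ultrafilter X

/-- An open filter: it contains the interior of each of its members. -/
def IsOpenFilter {X : Type u} [TopologicalSpace X] (F : Filter X) : Prop :=
  ∀ A ∈ F, interior A ∈ F

/-- The set of the ultrafilters that extend the filter `F`. -/
def AlexExt.extending {X : Type u} (F : Filter X) : Set (AlexExt X) :=
  {w : Ultrafilter X | ∀ A ∈ F, A ∈ w}

/-- The topology of the Alexandroff extension. -/
instance AlexExt.instTopologicalSpace (X : Type u) [TopologicalSpace X] :
    TopologicalSpace (AlexExt X) :=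
  TopologicalSpace.generateFrom
    {S : Set (AlexExt X) | ∃ F : Filter X, IsOpenFilter F ∧ S = AlexExt.extending F}

/-- The principal ultrafilter at `y`. -/
def AlexExt.principal {Y : Type u} (y : Y) : AlexExt Y := (pure y : Ultrafilter Y)

/-- `Y` is a topological ultrafilter morphic image (u-morphic image) of `X`: some surjective
interior (continuous and open) map from `X` to the Alexandroff extension of `Y` hits each
principal ultrafilter exactly once. -/
def IsUMorphicImage (Y X : Type u) [TopologicalSpace Y] [TopologicalSpace X] : Prop :=
  ∃ f : X → AlexExt Y, Continuous f ∧ IsOpenMap f ∧ Function.Surjective f ∧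
    ∀ y : Y, ∃! x : X, f x = AlexExt.principal y

/-! ### Classes of spaces -/

/-- A class of (non-empty) topological spaces. -/
abbrev SpaceClass : Type (u + 1) :=
  ∀ (X : Type u) [TopologicalSpace X] [Nonempty X], Prop

/-- The class is defined by a set of `L_t`-sentences (without unary predicates). -/
def IsLtDefinable (K : SpaceClass.{u}) : Prop :=
  ∃ T : Set (L2Formula Empty), (∀ φ ∈ T, φ.IsLt ∧ φ.IsSentence) ∧
    ∀ (X : Type u) [TopologicalSpace X] [Nonempty X], K X ↔ ∀ φ ∈ T, φ.TrueIn X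

/-- The class is defined by a set of `H(@)`-formulas. -/
def IsHAtDefinable (K : SpaceClass.{u}) : Prop :=
  ∃ Γ : Set HFormula,
    ∀ (X : Type u) [TopologicalSpace X] [Nonempty X], K X ↔ ∀ φ ∈ Γ, φ.Valid X

/-- The class is closed under u-morphic images. -/
def ClosedUnderUMorphicImages (K : SpaceClass.{u}) : Prop :=
  ∀ (X Y : Type u) [TopologicalSpace X] [Nonempty X] [TopologicalSpace Y] [Nonempty Y],
    K X → IsUMorphicImage Y X → K Y

/-- The class is closed under (non-empty) open subspaces. -/
def ClosedUnderOpenSubspaces (K : SpaceClass.{u}) : Prop :=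
  ∀ (X : Type u) [TopologicalSpace X] [Nonempty X] (O : Set X) [Nonempty O],
    K X → IsOpen O → K O

end TopoModal

/-!
A class `K` defined by a set of `H(@)`-formulas is closed under open subspaces, because a
valuation on an open subspace is also one on the whole space, and under u-morphic images, because
a valuation on `Y` pulls back along an interior map `f : X → Y*` so that a point `x` satisfies `φ`
if and only if the truth set of `φ` in `Y` belongs to the ultrafilter `f x`
(`HFormula.truthSet_pullback`). The points over the principal ultrafilters interpret the nominals.

Conversely, let `K` be `L_t`-definable and closed under both constructions, and let `Y` validate
every hybrid formula that is valid throughout `K`. The aim is a space in `K` of which `Y` is a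
u-morphic image. Use letters for subsets of `Y` and nominals for its points. For finitely many
subsets of `Y`, the facts about their complements, intersections, interiors and one-element members
are expressed by a formula `δ` that is true throughout `Y`; so `@ᵢ □ δ`, for the finitely many
relevant nominals `i`, is satisfiable in a space of `K`, and `δ` is true throughout an open subspace
that contains the points denoted by these nominals. This subspace is in `K`
(`exists_isSetRep_of_finite`).

These finite representations `Z j`, indexed by `j : Finset (Set Y)`, are put together in a limit
ultraproduct `LimProd`. Its index set consists of pairs of some `j` and an infinite sequence of
further finite sets; a point is a function that depends on finitely many coordinates only, modulo an
iterated product of ultrafilters; and the internal open sets form a base of its topology. Łoś's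
theorem holds for formulas whose open variables range over this base
(`L2Formula.sat_star_iff`), and truth of `L_t`-formulas does not depend on the base
(`L2Formula.IsLt.sat_basis_iff`), so the limit ultraproduct is in `K`. On the other hand, given
points and open sets depending on the first `n` coordinates, the next coordinate is a generic
finite set, and this realizes infinitely many conditions at once: intersections of represented open
sets are open (`exists_isOpen_subset_starRep`), and ultrafilters over `Y` that are approximated in an internal
open set are realized in it (`exists_forall_mem_starRep`). With this much saturation, the map that
sends a point to the ultrafilter of the sets representing it is a u-morphism
(`IsSetRep.isUMorphicImage`). Iterating an arbitrary ultrafilter over this index set takes the place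
of a good ultrafilter.
-/

namespace TopoModal

open Set Filter

/-! ### Truth of hybrid formulas -/

namespace HFormula

section

variable {X : Type u} [TopologicalSpace X] (ν : HValuation X)

/-- The set of the points at which `φ` is true. -/
def truthSet (φ : HFormula) : Set X := {w | Sat ν w φ}

theorem mem_truthSet {φ : HFormula} {w : X} : w ∈ truthSet ν φ ↔ Sat ν w φ := Iff.rfl

theorem truthSet_box (φ : HFormula) : truthSet ν (box φ) = interior (truthSet ν φ) := by
  ext w
  rw [mem_interior]
  exact ⟨fun ⟨O, hO, hw, h⟩ => ⟨O, h, hO, hw⟩, fun ⟨O, h, hO, hw⟩ => ⟨O, hO, hw, h⟩⟩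

/-- The biconditional `φ ↔ ψ`, expressed by conjunction and negation. -/
def iff (φ ψ : HFormula) : HFormula := and (neg (and φ (neg ψ))) (neg (and ψ (neg φ)))

theorem sat_iff {φ ψ : HFormula} {w : X} : Sat ν w (iff φ ψ) ↔ (Sat ν w φ ↔ Sat ν w ψ) := by
  simp only [iff, Sat]
  tauto

/-- The conjunction of a list of formulas. -/
def conj : List HFormula → HFormula
  | [] => verum
  | φ :: l => and φ (conj l)

theorem sat_conj {l : List HFormula} {w : X} : Sat ν w (conj l) ↔ ∀ φ ∈ l, Sat ν w φ := by
  induction l with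
  | nil => simp [conj, Sat]
  | cons φ l ih => simp [conj, Sat, ih]

end

/-- Truth in an open subspace agrees with truth in the whole space under the same valuation. -/
theorem sat_subtype_iff {X : Type u} [TopologicalSpace X] {O : Set X} (hO : IsOpen O)
    (ν : HValuation O) (φ : HFormula) (w : O) :
    Sat ν w φ ↔ Sat ⟨fun p => Subtype.val '' ν.prop p, fun i => ν.nom i⟩ (w : X) φ := by
  induction φ generalizing w with
  | verum => rfl
  | letter p => simp [Sat]
  | nominal i => exact Subtype.ext_iff
  | and φ ψ ih₁ ih₂ => exact and_congr (ih₁ w) (ih₂ w)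
  | neg φ ih => exact not_congr (ih w)
  | atNom i φ ih => exact ih _
  | box φ ih =>
    rw [← mem_truthSet, ← mem_truthSet, truthSet_box, truthSet_box, ← mem_preimage,
      hO.isOpenMap_subtype_val.preimage_interior_eq_interior_preimage continuous_subtype_val]
    have : truthSet ν φ = Subtype.val ⁻¹'
        truthSet ⟨fun p => Subtype.val '' ν.prop p, fun i => (ν.nom i : X)⟩ φ := ext ih
    rw [this]

end HFormula

theorem IsHAtDefinable.closedUnderOpenSubspaces {K : SpaceClass.{u}} (hK : IsHAtDefinable K) :
    ClosedUnderOpenSubspaces K := by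
  obtain ⟨Γ, hΓ⟩ := hK
  intro X _ _ O _ hX hO
  rw [hΓ] at hX ⊢
  exact fun φ hφ ν w => (HFormula.sat_subtype_iff hO ν φ w).2 (hX φ hφ _ _)

/-! ### The Alexandroff extension -/

section AlexExt

variable {Y : Type u}

/-- A point of the Alexandroff extension, regarded as the ultrafilter that it is. -/
def AlexExt.toUltrafilter (w : AlexExt Y) : Ultrafilter Y := w

/-- The set of the ultrafilters that contain `A`. -/
def AlexExt.hat (A : Set Y) : Set (AlexExt Y) := {w : Ultrafilter Y | A ∈ w}

theorem AlexExt.mem_hat {A : Set Y} {w : AlexExt Y} :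
    w ∈ AlexExt.hat A ↔ A ∈ w.toUltrafilter := Iff.rfl

theorem AlexExt.mem_extending {F : Filter Y} {w : AlexExt Y} :
    w ∈ AlexExt.extending F ↔ (w.toUltrafilter : Filter Y) ≤ F := Iff.rfl

theorem AlexExt.eq_principal_iff {w : AlexExt Y} {y : Y} :
    w = AlexExt.principal y ↔ w ∈ AlexExt.hat {y} := by
  constructor
  · rintro rfl
    exact Ultrafilter.mem_pure.2 rfl
  · intro h
    refine Ultrafilter.eq_of_le (f := w.toUltrafilter) (g := (pure y : Ultrafilter Y)) ?_
    rw [Ultrafilter.coe_pure, Filter.le_pure_iff]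
    exact h

variable [TopologicalSpace Y]

theorem IsOpenFilter.inf {F G : Filter Y} (hF : IsOpenFilter F) (hG : IsOpenFilter G) :
    IsOpenFilter (F ⊓ G) := by
  intro A hA
  obtain ⟨B, hB, C, hC, rfl⟩ := Filter.mem_inf_iff.1 hA
  rw [interior_inter]
  exact Filter.inter_mem_inf (hF B hB) (hG C hC)

theorem isOpenFilter_principal {O : Set Y} (hO : IsOpen O) : IsOpenFilter (𝓟 O) := by
  intro A hA
  rw [Filter.mem_principal] at hA ⊢
  exact interior_maximal hA hO

/-- The sets `{u | F ⊆ u}`, with `F` an open filter, form a base and not just a subbase. -/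
theorem AlexExt.isTopologicalBasis :
    TopologicalSpace.IsTopologicalBasis
      {S : Set (AlexExt Y) | ∃ F : Filter Y, IsOpenFilter F ∧ S = AlexExt.extending F} := by
  refine ⟨?_, ?_, rfl⟩
  · rintro _ ⟨F, hF, rfl⟩ _ ⟨G, hG, rfl⟩ w hw
    refine ⟨_, ⟨F ⊓ G, hF.inf hG, rfl⟩, ?_, ?_⟩
    · exact mem_extending.2 (le_inf (mem_extending.1 hw.1) (mem_extending.1 hw.2))
    · exact fun v hv => ⟨mem_extending.2 ((mem_extending.1 hv).trans inf_le_left),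
        mem_extending.2 ((mem_extending.1 hv).trans inf_le_right)⟩
  · refine eq_univ_of_forall fun w => ⟨_, ⟨⊤, ?_, rfl⟩, mem_extending.2 le_top⟩
    rintro A hA
    rw [Filter.mem_top.1 hA, interior_univ]
    exact Filter.univ_mem

theorem AlexExt.isOpen_hat {O : Set Y} (hO : IsOpen O) : IsOpen (AlexExt.hat O) := by
  refine AlexExt.isTopologicalBasis.isOpen ⟨𝓟 O, isOpenFilter_principal hO, ?_⟩
  ext w
  rw [mem_extending, mem_hat, Filter.le_principal_iff, Ultrafilter.mem_coe]

/-- The interior in `Y*` of the set of the ultrafilters that contain `A` is determined by the interior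
of `A`: an open filter all of whose ultrafilters contain `A` contains `A`. -/
theorem AlexExt.interior_hat (A : Set Y) :
    interior (AlexExt.hat A) = AlexExt.hat (interior A) := by
  apply Subset.antisymm
  · intro w hw
    obtain ⟨_, ⟨F, hF, rfl⟩, hwF, hFA⟩ :=
      AlexExt.isTopologicalBasis.mem_nhds_iff.1 (mem_interior_iff_mem_nhds.1 hw)
    have hA : A ∈ F := by
      rw [Filter.mem_iff_ultrafilter]
      exact fun v hv => hFA (a := v) hv
    exact mem_extending.1 hwF (hF A hA)
  · refine interior_maximal (fun w hw => ?_) (isOpen_hat isOpen_interior)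
    exact Filter.mem_of_superset (f := (w.toUltrafilter : Filter Y)) hw interior_subset

end AlexExt

/-- Under the pullback `μ` of a valuation `ν` on `Y` along an interior map `f : X → Y*`, a point of
`X` satisfies a formula if and only if the truth set of this formula in `Y` belongs to the image
of the point. -/
theorem HFormula.truthSet_pullback {X Y : Type u} [TopologicalSpace X] [TopologicalSpace Y]
    {f : X → AlexExt Y} (hf : Continuous f) (ho : IsOpenMap f) (ν : HValuation Y)
    (μ : HValuation X) (hp : ∀ p, μ.prop p = f ⁻¹' AlexExt.hat (ν.prop p))
    (hn : ∀ i x, x = μ.nom i ↔ f x = AlexExt.principal (ν.nom i)) (φ : HFormula) :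
    truthSet μ φ = f ⁻¹' AlexExt.hat (truthSet ν φ) := by
  induction φ with
  | verum =>
    ext x
    exact iff_of_true trivial (Filter.univ_mem (f := ((f x).toUltrafilter : Filter Y)))
  | letter p => exact hp p
  | nominal i =>
    ext x
    exact (hn i x).trans AlexExt.eq_principal_iff
  | and φ ψ ih₁ ih₂ =>
    ext x
    exact (and_congr (Set.ext_iff.1 ih₁ x) (Set.ext_iff.1 ih₂ x)).trans
      Filter.inter_mem_iff.symm
  | neg φ ih =>
    ext x
    exact (not_congr (Set.ext_iff.1 ih x)).trans
      (Ultrafilter.compl_mem_iff_notMem (f := (f x).toUltrafilter)).symm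
  | box φ ih =>
    rw [truthSet_box, truthSet_box, ih, ← ho.preimage_interior_eq_interior_preimage hf,
      AlexExt.interior_hat]
  | atNom i φ ih =>
    ext x
    have h : Sat μ (μ.nom i) φ ↔ Sat ν (ν.nom i) φ := by
      have := Set.ext_iff.1 ih (μ.nom i)
      rw [mem_preimage, (hn i _).1 rfl] at this
      exact this.trans Ultrafilter.mem_pure
    exact h.trans (Filter.eventually_const (f := ((f x).toUltrafilter : Filter Y))).symm

theorem IsHAtDefinable.closedUnderUMorphicImages {K : SpaceClass.{u}} (hK : IsHAtDefinable K) :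
    ClosedUnderUMorphicImages K := by
  obtain ⟨Γ, hΓ⟩ := hK
  rintro X Y _ _ _ _ hX ⟨f, hf, ho, hs, hu⟩
  rw [hΓ] at hX ⊢
  intro φ hφ ν y
  choose n hn hn' using hu
  have key := HFormula.truthSet_pullback hf ho ν
    ⟨fun p => f ⁻¹' AlexExt.hat (ν.prop p), fun i => n (ν.nom i)⟩ (fun _ => rfl)
    (fun i x => ⟨fun h => h ▸ hn _, hn' _ _⟩) φ
  have := Set.ext_iff.1 key (n y)
  rw [mem_preimage, hn] at this
  exact Ultrafilter.mem_pure.1 (this.1 (hX φ hφ _ _))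

/-! ### Topological invariance of `L_t` -/

namespace L2Formula

variable {P : Type v} {X : Type u} {σ : Set (Set X)} {ν : P → Set X}

theorem sat_congr_free {φ : L2Formula P} {g g' : ℕ → X} {G G' : ℕ → Set X}
    (hg : ∀ x ∈ φ.freePt, g x = g' x) (hG : ∀ U ∈ φ.freeOp, G U = G' U) :
    Sat σ ν g G φ ↔ Sat σ ν g' G' φ := by
  induction φ generalizing g g' G G' with
  | verum => rfl
  | eqPt x y => simp only [Sat, hg x (by simp [freePt]), hg y (by simp [freePt])]
  | eqOp U V => simp only [Sat, hG U (by simp [freeOp]), hG V (by simp [freeOp])]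
  | pred p x => simp only [Sat, hg x (by simp [freePt])]
  | mem x U => simp only [Sat, hg x (by simp [freePt]), hG U (by simp [freeOp])]
  | neg φ ih => exact not_congr (ih hg hG)
  | and φ ψ ih₁ ih₂ =>
    exact and_congr (ih₁ (fun x h => hg x (.inl h)) fun U h => hG U (.inl h))
      (ih₂ (fun x h => hg x (.inr h)) fun U h => hG U (.inr h))
  | exPt x φ ih =>
    refine exists_congr fun d => ih (fun y hy => ?_) hG
    by_cases h : y = x
    · subst h; simp
    · simp [h, hg y ⟨hy, h⟩]
  | exOp U φ ih =>
    refine exists_congr fun O => and_congr_right fun _ => ih hg fun V hV => ?_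
    by_cases h : V = U
    · subst h; simp
    · simp [h, hG V ⟨hV, h⟩]

/-- Truth is monotone in an open variable of positive polarity and antitone in one of negative
polarity. -/
theorem sat_update_of_hasPolarity {U : ℕ} {φ : L2Formula P} {s : Bool} (h : φ.HasPolarity U s)
    {g : ℕ → X} {G : ℕ → Set X} {A B : Set X} (hAB : A ⊆ B) :
    Sat σ ν g (Function.update G U (if s then A else B)) φ →
      Sat σ ν g (Function.update G U (if s then B else A)) φ := by
  induction φ generalizing s g G with
  | verum => exact id
  | eqPt x y => exact id
  | eqOp V W => simp [Sat, h.1, h.2]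
  | pred p x => exact id
  | mem x V =>
    by_cases hV : V = U
    · subst hV
      have hs : s = true := h rfl
      subst hs
      simpa [Sat] using fun hx => hAB hx
    · simp [Sat, hV]
  | neg φ ih =>
    have := @ih (!s) h g G
    cases s <;> exact mt this
  | and φ ψ ih₁ ih₂ => exact And.imp (ih₁ h.1) (ih₂ h.2)
  | exPt x φ ih => exact Exists.imp fun d => ih h
  | exOp V φ ih =>
    refine Exists.imp fun O => And.imp_right ?_
    by_cases hV : V = U
    · subst hV
      simp
    · rw [Function.update_comm (Ne.symm hV), Function.update_comm (Ne.symm hV)]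
      exact ih (h.resolve_left hV)

/-- The truth of an `L_t`-formula does not depend on whether open variables range over all open
sets or only over a base of the topology. -/
theorem IsLt.sat_basis_iff [TopologicalSpace X] (hσ : TopologicalSpace.IsTopologicalBasis σ)
    {φ : L2Formula P} (hφ : φ.IsLt) (g : ℕ → X) (G : ℕ → Set X) :
    Sat σ ν g G φ ↔ Sat {O : Set X | IsOpen O} ν g G φ := by
  induction hφ generalizing g G with
  | verum => rfl
  | eqPt x y => rfl
  | eqOp U V => rfl
  | pred p x => rfl
  | mem x U => rfl
  | neg _ ih => exact not_congr (ih g G)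
  | and _ _ ih₁ ih₂ => exact and_congr (ih₁ g G) (ih₂ g G)
  | exPt x _ ih => exact exists_congr fun d => ih _ G
  | allNhd x U _ hα ih =>
    simp only [allOp, imp, Sat, Function.update_self, not_exists, not_and, not_not]
    constructor
    · intro h O hO hx
      obtain ⟨B, hB, hxB, hBO⟩ := hσ.exists_subset_of_mem_open hx hO
      exact sat_update_of_hasPolarity (s := true) hα hBO ((ih _ _).1 (h B hB hxB))
    · exact fun h B hB hx => (ih _ _).2 (h B (hσ.isOpen hB) hx)
  | exNhd x U _ hα ih =>
    simp only [Sat, Function.update_self]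
    constructor
    · rintro ⟨B, hB, hx, h⟩
      exact ⟨B, hσ.isOpen hB, hx, (ih _ _).1 h⟩
    · rintro ⟨O, hO, hx, h⟩
      obtain ⟨B, hB, hxB, hBO⟩ := hσ.exists_subset_of_mem_open hx hO
      exact ⟨B, hB, hxB, (ih _ _).2 (sat_update_of_hasPolarity (s := false) hα hBO h)⟩

end L2Formula

/-! ### Representations of subsets -/

/-- A map `P` from the subsets of `Y` to those of `X` and a map `N` from points to points respect,
as far as the members of `s` are concerned, complements, intersections, interiors and
singletons. -/
structure IsSetRep {X Y : Type u} [TopologicalSpace X] [TopologicalSpace Y] (s : Set (Set Y))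
    (P : Set Y → Set X) (N : Y → X) : Prop where
  compl : ∀ A ∈ s, P Aᶜ = (P A)ᶜ
  inter : ∀ A ∈ s, ∀ B ∈ s, P (A ∩ B) = P A ∩ P B
  interior : ∀ A ∈ s, P (interior A) = interior (P A)
  singleton : ∀ y, {y} ∈ s → P {y} = {N y}

section UMorphic

variable {X Y : Type u} [TopologicalSpace X] [TopologicalSpace Y] {P : Set Y → Set X} {N : Y → X}

theorem IsSetRep.mono (h : IsSetRep univ P N) {A B : Set Y} (hAB : A ⊆ B) : P A ⊆ P B := by
  rw [← inter_eq_left, ← h.inter _ trivial _ trivial, inter_eq_left.2 hAB]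

theorem IsSetRep.empty (h : IsSetRep univ P N) : P ∅ = ∅ := by
  rw [← inter_compl_self ∅, h.inter _ trivial _ trivial, h.compl _ trivial, inter_compl_self]

theorem IsSetRep.mem_of_mem (h : IsSetRep univ P N) {A : Set Y} {y : Y} (hy : y ∈ A) :
    N y ∈ P A :=
  h.mono (singleton_subset_iff.2 hy) ((h.singleton y trivial).symm ▸ rfl)

/-- A point `x` of `X` gives the ultrafilter of the `A` with `x ∈ P A`. -/
def IsSetRep.toAlexExt (h : IsSetRep univ P N) (x : X) : AlexExt Y :=
  Ultrafilter.ofComplNotMemIff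
    { sets := {A | x ∈ P A}
      univ_sets := by
        have : P univ = univ := by rw [← compl_empty, h.compl _ trivial, h.empty, compl_empty]
        exact (Set.ext_iff.1 this x).2 trivial
      sets_of_superset := fun hA hAB => h.mono hAB hA
      inter_sets := fun {A B} hA hB => (Set.ext_iff.1 (h.inter A trivial B trivial) x).2 ⟨hA, hB⟩ }
    fun A => by
      change ¬ x ∈ P Aᶜ ↔ x ∈ P A
      rw [h.compl _ trivial, mem_compl_iff, not_not]

theorem IsSetRep.toAlexExt_mem_hat (h : IsSetRep univ P N) {x : X} {A : Set Y} :
    h.toAlexExt x ∈ AlexExt.hat A ↔ x ∈ P A := Iff.rfl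

/-- A total representation makes `Y` a u-morphic image of `X`, provided that `X` is saturated:
the infinite intersections needed for continuity are open, and an ultrafilter whose members
all meet a basic open set is realized there. -/
theorem IsSetRep.isUMorphicImage [Nonempty X] (h : IsSetRep univ P N) {σ : Set (Set X)}
    (hσ : TopologicalSpace.IsTopologicalBasis σ) (hσu : univ ∈ σ)
    (hopen : ∀ x : X, ∃ U, IsOpen U ∧ x ∈ U ∧ ∀ A, x ∈ _root_.interior (P A) → U ⊆ P A)
    (hreal : ∀ U ∈ σ, ∀ v : Ultrafilter Y, (∀ A ∈ v, (U ∩ P A).Nonempty) →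
      ∃ x ∈ U, ∀ A ∈ v, x ∈ P A) :
    IsUMorphicImage Y X := by
  have heq : ∀ (x : X) (v : Ultrafilter Y), (∀ A ∈ v, x ∈ P A) → h.toAlexExt x = v :=
    fun x v hx => Ultrafilter.eq_of_le (f := (h.toAlexExt x).toUltrafilter) hx
  refine ⟨h.toAlexExt, ?_, ?_, ?_, ?_⟩
  · refine AlexExt.isTopologicalBasis.continuous_iff.2 ?_
    rintro _ ⟨F, hF, rfl⟩
    refine isOpen_iff_mem_nhds.2 fun x hx => ?_
    obtain ⟨U, hU, hxU, hUP⟩ := hopen x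
    refine mem_of_superset (hU.mem_nhds hxU) fun z hz A hA => ?_
    refine hUP A ?_ hz
    rw [← h.interior A trivial]
    exact hx _ (hF A hA)
  · refine hσ.isOpenMap_iff.2 fun U hU => isOpen_iff_mem_nhds.2 ?_
    rintro _ ⟨x, hx, rfl⟩
    -- The neighbourhood consists of the ultrafilters that contain all open sets in the image of
    -- `x`; a member of such an ultrafilter cannot be missed by `U`, since the interior of its
    -- complement would be one of those open sets.
    let F : Filter Y := ⨅ O : {O : Set Y // IsOpen O ∧ x ∈ P O}, 𝓟 O.1
    have hF : ∀ {A : Set Y}, A ∈ F ↔ x ∈ P (_root_.interior A) := by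
      intro A
      constructor
      · intro hA
        have : Nonempty {O : Set Y // IsOpen O ∧ x ∈ P O} :=
          ⟨univ, isOpen_univ, univ_mem (f := ((h.toAlexExt x).toUltrafilter : Filter Y))⟩
        obtain ⟨O, hO⟩ := (mem_iInf_of_directed (fun O₁ O₂ => ⟨⟨O₁.1 ∩ O₂.1, O₁.2.1.inter O₂.2.1,
          by rw [h.inter _ trivial _ trivial]; exact ⟨O₁.2.2, O₂.2.2⟩⟩,
          by simp, by simp⟩) A).1 hA
        exact h.mono (interior_maximal hO O.2.1) O.2.2
      · intro hA
        exact mem_iInf_of_mem ⟨_, isOpen_interior, hA⟩ interior_subset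
    have hFo : IsOpenFilter F := fun A hA => hF.2 (by rw [interior_interior]; exact hF.1 hA)
    refine mem_of_superset ((AlexExt.isTopologicalBasis.isOpen ⟨F, hFo, rfl⟩).mem_nhds
      fun A hA => h.mono interior_subset (hF.1 hA)) fun v hv => ?_
    obtain ⟨z, hz, hzv⟩ := hreal U hU v fun A hA => by
      by_contra hne
      have hUA : U ⊆ P Aᶜ := by
        rw [h.compl A trivial]
        exact fun w hw hwA => hne ⟨w, hw, hwA⟩
      have : x ∈ P (_root_.interior Aᶜ) := by
        rw [h.interior _ trivial]
        exact interior_maximal hUA (hσ.isOpen hU) hx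
      exact Ultrafilter.compl_mem_iff_notMem.1 (hv _ (hF.2 this)) hA
    exact ⟨z, hz, heq z v hzv⟩
  · intro v
    obtain ⟨x, -, hx⟩ := hreal univ hσu v fun A hA => by
      obtain ⟨y, hy⟩ := Ultrafilter.nonempty_of_mem hA
      exact ⟨N y, trivial, h.mem_of_mem hy⟩
    exact ⟨x, heq x v hx⟩
  · intro y
    have key : ∀ x, h.toAlexExt x = AlexExt.principal y ↔ x = N y := by
      intro x
      rw [AlexExt.eq_principal_iff, h.toAlexExt_mem_hat, h.singleton y trivial, mem_singleton_iff]
    exact ⟨N y, (key _).2 rfl, fun x hx => (key x).1 hx⟩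

end UMorphic

/-! ### Finite representations from validity -/

/-- If every hybrid formula that is valid throughout `K` is valid in `Y`, then finitely many
subsets of `Y` can be represented in a space of `K`. -/
theorem exists_isSetRep_of_finite {K : SpaceClass.{u}} (hO : ClosedUnderOpenSubspaces K)
    {Y : Type u} [TopologicalSpace Y] [Nonempty Y]
    (hY : ∀ φ : HFormula, (∀ (X : Type u) [TopologicalSpace X] [Nonempty X], K X → φ.Valid X) →
      φ.Valid Y) {s : Set (Set Y)} (hs : s.Finite) :
    ∃ (Z : Type u) (_ : TopologicalSpace Z) (_ : Nonempty Z) (P : Set Y → Set Z) (N : Y → Z),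
      K Z ∧ IsSetRep s P N := by
  classical
  obtain ⟨y₀⟩ := ‹Nonempty Y›
  -- `t` contains all sets for which a letter is needed; a nonempty list of named points is
  -- ensured by adding `{y₀}`.
  obtain ⟨s', rfl⟩ : ∃ s' : Finset (Set Y), s = s' := ⟨hs.toFinset, by simp⟩
  set s := insert {y₀} s'
  set t : Finset (Set Y) := s ∪ s.image compl ∪ s.image interior ∪
    (s ×ˢ s).image (fun q => q.1 ∩ q.2) with ht
  have hst : ∀ {A}, A ∈ s → A ∈ t := fun {A} h => by simp only [ht, Finset.mem_union]; tauto
  have hct : ∀ {A}, A ∈ s → Aᶜ ∈ t := fun {A} h => by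
    simp only [ht, Finset.mem_union]
    exact .inl (.inl (.inr (Finset.mem_image_of_mem _ h)))
  have hit : ∀ {A}, A ∈ s → interior A ∈ t := fun {A} h => by
    simp only [ht, Finset.mem_union]
    exact .inl (.inr (Finset.mem_image_of_mem _ h))
  have hnt : ∀ {A B}, A ∈ s → B ∈ s → A ∩ B ∈ t := fun {A B} h h' => by
    simp only [ht, Finset.mem_union]
    exact .inr (Finset.mem_image.2 ⟨(A, B), Finset.mem_product.2 ⟨h, h'⟩, rfl⟩)
  obtain ⟨e, he⟩ : ∃ e : Set Y → ℕ, InjOn e t := by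
    obtain ⟨e, he⟩ := Set.countable_iff_exists_injOn.1 t.countable_toSet
    exact ⟨e, he⟩
  -- The letter `e A` denotes `A` in `Y`, and the nominal `e {y}` denotes `y`, for `A ∈ t`, `{y} ∈ s`.
  let dec : ℕ → Set Y := fun n => Function.invFunOn e t n
  have hdec : ∀ {A}, A ∈ t → dec (e A) = A := fun {A} hA => he.leftInvOn_invFunOn hA
  let ν : HValuation Y := ⟨dec, fun n => if h : ∃ y, dec n = {y} then h.choose else y₀⟩
  have hnom : ∀ {y}, {y} ∈ s → ν.nom (e {y}) = y := by
    intro y hy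
    have h : ∃ z, dec (e {y}) = {z} := ⟨y, hdec (hst hy)⟩
    have h' : ν.nom (e {y}) = h.choose := dif_pos h
    rw [h']
    exact (singleton_injective (h.choose_spec.symm.trans (hdec (hst hy))))
  let names : Finset (Set Y) := s.filter fun A => ∃ y, A = {y}
  have hnames : ∀ {y}, {y} ∈ s → {y} ∈ names := fun {y} hy => Finset.mem_filter.2 ⟨hy, y, rfl⟩
  -- The conjunction of `Δ` says that the letters and nominals respect complements, interiors,
  -- singletons and intersections.
  let Δ : List HFormula :=
    s.toList.map (fun A => .iff (.letter (e Aᶜ)) (.neg (.letter (e A)))) ++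
    (s.toList.map (fun A => .iff (.letter (e (interior A))) (.box (.letter (e A)))) ++
    (names.toList.map (fun A => .iff (.letter (e A)) (.nominal (e A))) ++
    (s ×ˢ s).toList.map
      (fun q => .iff (.letter (e (q.1 ∩ q.2))) (.and (.letter (e q.1)) (.letter (e q.2))))))
  have hΔ : ∀ w, HFormula.Sat ν w (HFormula.conj Δ) := by
    intro w
    rw [HFormula.sat_conj]
    simp only [Δ, List.mem_append, List.mem_map, Finset.mem_toList, Finset.mem_product]
    rintro φ (⟨A, hA, rfl⟩ | ⟨A, hA, rfl⟩ | ⟨A, hA, rfl⟩ | ⟨q, hq, rfl⟩) <;> rw [HFormula.sat_iff]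
    · change w ∈ dec _ ↔ ¬ w ∈ dec _
      rw [hdec (hct hA), hdec (hst hA), mem_compl_iff]
    · rw [← HFormula.mem_truthSet, ← HFormula.mem_truthSet, HFormula.truthSet_box]
      change w ∈ dec _ ↔ w ∈ interior (dec _)
      rw [hdec (hit hA), hdec (hst hA)]
    · obtain ⟨hA, y, rfl⟩ := Finset.mem_filter.1 hA
      change w ∈ dec _ ↔ w = ν.nom _
      rw [hdec (hst hA), hnom hA, mem_singleton_iff]
    · change w ∈ dec _ ↔ w ∈ dec _ ∧ w ∈ dec _
      rw [hdec (hnt hq.1 hq.2), hdec (hst hq.1), hdec (hst hq.2), mem_inter_iff]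
  let θ : HFormula := .conj (names.toList.map fun A => .atNom (e A) (.box (.conj Δ)))
  have hθ : HFormula.Sat ν y₀ θ := by
    rw [HFormula.sat_conj]
    simp only [List.mem_map]
    rintro φ ⟨A, -, rfl⟩
    exact ⟨univ, isOpen_univ, trivial, fun v _ => hΔ v⟩
  obtain ⟨X, _, _, hX, μ, w, hw⟩ : ∃ (X : Type u) (_ : TopologicalSpace X) (_ : Nonempty X),
      K X ∧ ∃ (μ : HValuation X) (w : X), HFormula.Sat μ w θ := by
    by_contra hne
    refine hY (.neg θ) (fun X _ _ hX μ w hw => hne ⟨X, _, _, hX, μ, w, hw⟩) ν y₀ hθ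
  -- The open subspace on which `Δ` is true; it contains the points denoted by the relevant nominals.
  let O : Set X := interior (HFormula.truthSet μ (.conj Δ))
  have hOo : IsOpen O := isOpen_interior
  have hnO : ∀ {y}, {y} ∈ s → μ.nom (e {y}) ∈ O := by
    intro y hy
    have := HFormula.sat_conj μ |>.1 hw _
      (List.mem_map.2 ⟨_, Finset.mem_toList.2 (hnames hy), rfl⟩)
    change μ.nom (e {y}) ∈ HFormula.truthSet μ (.box (.conj Δ)) at this
    rwa [HFormula.truthSet_box] at this
  have hΔO : ∀ v : O, ∀ φ ∈ Δ, HFormula.Sat μ (v : X) φ := fun v =>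
    (HFormula.sat_conj μ).1 (show (v : X) ∈ HFormula.truthSet μ (.conj Δ) from interior_subset v.2)
  simp only [Δ, List.mem_append, List.mem_map, Finset.mem_toList, Finset.mem_product] at hΔO
  have h₀ : {y₀} ∈ s := Finset.mem_insert_self _ _
  have hneO : Nonempty O := ⟨⟨_, hnO h₀⟩⟩
  have hsub : ∀ {A : Set Y}, A ∈ (s' : Set (Set Y)) → A ∈ s := fun {A} h =>
    Finset.mem_insert_of_mem h
  -- Points `y` with `{y} ∉ s` are irrelevant to the representation.
  refine ⟨O, inferInstance, hneO, fun A => Subtype.val ⁻¹' μ.prop (e A),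
    fun y => if hy : {y} ∈ s then ⟨_, hnO hy⟩ else ⟨_, hnO h₀⟩, hO X O hX hOo, ?_, ?_, ?_, ?_⟩
  · intro A hA
    ext v
    exact (HFormula.sat_iff μ).1 (hΔO v _ (.inl ⟨A, hsub hA, rfl⟩))
  · intro A hA B hB
    ext v
    exact (HFormula.sat_iff μ).1
      (hΔO v _ (.inr (.inr (.inr ⟨(A, B), ⟨hsub hA, hsub hB⟩, rfl⟩))))
  · intro A hA
    rw [← hOo.isOpenMap_subtype_val.preimage_interior_eq_interior_preimage
      continuous_subtype_val]
    ext v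
    have := (HFormula.sat_iff μ).1 (hΔO v _ (.inr (.inl ⟨A, hsub hA, rfl⟩)))
    rw [← HFormula.mem_truthSet, ← HFormula.mem_truthSet, HFormula.truthSet_box] at this
    exact this
  · intro y hy
    ext v
    rw [dif_pos (hsub hy), mem_singleton_iff, Subtype.ext_iff]
    exact (HFormula.sat_iff μ).1
      (hΔO v _ (.inr (.inr (.inl ⟨{y}, hnames (hsub hy), rfl⟩))))

/-! ### Limit ultraproducts -/

/-- The index set of the limit ultraproduct: a first coordinate, which selects the factor, and
a sequence of further coordinates. -/
abbrev LimIndex (J : Type u) : Type u := J × (ℕ → J)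

namespace LimIndex

variable {J : Type u} [Nonempty J]

open Classical in
/-- Forget (replace by an arbitrary constant) all coordinates of a sequence from the `n`-th. -/
noncomputable def truncSeq (n : ℕ) (s : ℕ → J) : ℕ → J :=
  fun k => if k < n then s k else Classical.arbitrary J

theorem truncSeq_truncSeq {n m : ℕ} (h : n ≤ m) (s : ℕ → J) :
    truncSeq n (truncSeq m s) = truncSeq n s := by
  funext k
  by_cases hk : k < n
  · simp [truncSeq, hk, hk.trans_le h]
  · simp [truncSeq, hk]

/-- Forget all coordinates in the sequence from the `n`-th, and keep the first coordinate. -/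
noncomputable def trunc (n : ℕ) (ω : LimIndex J) : LimIndex J := (ω.1, truncSeq n ω.2)

/-- A dependent function on the index set, with factors selected by the first coordinate, depends
besides that coordinate only on the first `n` coordinates of the sequence. -/
def Dep {W : J → Type v} (n : ℕ) (x : ∀ ω : LimIndex J, W ω.1) : Prop :=
  ∀ ω, x ω = x (trunc n ω)

theorem Dep.mono {W : J → Type v} {n m : ℕ} (h : n ≤ m) {x : ∀ ω : LimIndex J, W ω.1}
    (hx : Dep n x) : Dep m x := by
  intro ω
  have h₁ : (x (trunc n (trunc m ω)) : W ω.1) = x (trunc n ω) :=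
    congrArg (β := W ω.1) (fun s => x (ω.1, s)) (truncSeq_truncSeq h ω.2)
  exact (hx ω).trans (h₁.symm.trans (hx (trunc m ω)).symm)

/-- A choice can be made that depends on no more coordinates than the condition does. -/
theorem exists_dep_choice {W : J → Type v} [∀ j, Nonempty (W j)] {n : ℕ}
    {R : ∀ ω : LimIndex J, W ω.1 → Prop} (hR : Dep (W := fun j => W j → Prop) n R) :
    ∃ x : ∀ ω : LimIndex J, W ω.1, Dep n x ∧ ∀ ω, (∃ d, R ω d) → R ω (x ω) := by
  classical
  let w : ∀ ω : LimIndex J, W ω.1 := fun ω =>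
    if h : ∃ d, R ω d then h.choose else Classical.arbitrary _
  refine ⟨fun ω => w (trunc n ω), fun ω => ?_, fun ω hω => ?_⟩
  · exact (congrArg (β := W ω.1) (fun s => w (ω.1, s)) (truncSeq_truncSeq le_rfl ω.2)).symm
  · have h : R ω = R (trunc n ω) := hR ω
    rw [h] at hω ⊢
    change R (trunc n ω) (w (trunc n ω))
    have : w (trunc n ω) = hω.choose := dif_pos hω
    rw [this]
    exact hω.choose_spec

open Classical in
/-- Replace the `n`-th coordinate of the sequence by `j`. -/
noncomputable def setCoord (n : ℕ) (j : J) (ω : LimIndex J) : LimIndex J :=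
  (ω.1, Function.update ω.2 n j)

theorem trunc_setCoord {n m : ℕ} (h : n ≤ m) (j : J) (ω : LimIndex J) :
    trunc n (setCoord m j ω) = trunc n ω := by
  refine Prod.ext rfl (funext fun k => ?_)
  by_cases hk : k < n
  · simp [trunc, truncSeq, setCoord, hk, (hk.trans_le h).ne]
  · simp [trunc, truncSeq, setCoord, hk]

/-- The iterated product of `n + 1` copies of an ultrafilter on the coordinates. The coordinate
added last is quantified outermost. -/
noncomputable def iterProd (D : Ultrafilter J) : ℕ → Ultrafilter (LimIndex J)
  | 0 => D.map fun j => (j, fun _ => Classical.arbitrary J)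
  | n + 1 => D.bind fun j => (iterProd D n).map (setCoord n j)

/-- The limit of the iterated products. On a set that depends on the first `n` coordinates of the
sequence, it agrees with `iterProd D m` for every `m ≥ n`. -/
noncomputable def limUltrafilter (D : Ultrafilter J) : Ultrafilter (LimIndex J) :=
  (hyperfilter ℕ).bind (iterProd D)

variable {D : Ultrafilter J}

theorem eventually_iterProd_iff {n m : ℕ} (h : n ≤ m) {p : LimIndex J → Prop}
    (hp : Dep (W := fun _ => Prop) n p) :
    (∀ᶠ ω in iterProd D m, p ω) ↔ ∀ᶠ ω in iterProd D n, p ω := by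
  induction m, h using Nat.le_induction with
  | base => rfl
  | succ m h ih =>
    rw [← ih]
    have : ∀ j ω, p (setCoord m j ω) = p ω := fun j ω =>
      (hp _).trans ((congrArg p (trunc_setCoord h j ω)).trans (hp ω).symm)
    change (∀ᶠ j in D, ∀ᶠ ω in iterProd D m, p (setCoord m j ω)) ↔ _
    simp only [this, eventually_const]

theorem eventually_limUltrafilter_iff {n : ℕ} {p : LimIndex J → Prop}
    (hp : Dep (W := fun _ => Prop) n p) :
    (∀ᶠ ω in limUltrafilter D, p ω) ↔ ∀ᶠ ω in iterProd D n, p ω := by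
  change (∀ᶠ m in hyperfilter ℕ, ∀ᶠ ω in iterProd D m, p ω) ↔ _
  have h : ∀ᶠ m in hyperfilter ℕ,
      ((∀ᶠ ω in iterProd D m, p ω) ↔ ∀ᶠ ω in iterProd D n, p ω) := by
    refine Nat.hyperfilter_le_atTop ((eventually_ge_atTop n).mono fun m hm => ?_)
    exact eventually_iterProd_iff hm hp
  rw [eventually_congr h, eventually_const]

theorem eventually_limUltrafilter_fst {p : J → Prop} (h : ∀ᶠ j in D, p j) :
    ∀ᶠ ω : LimIndex J in limUltrafilter D, p ω.1 :=
  (eventually_limUltrafilter_iff (n := 0) (p := fun ω : LimIndex J => p ω.1) fun _ => rfl).2 h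

theorem dep_succ_diagonal {n : ℕ} {p : J → LimIndex J → Prop}
    (hp : ∀ j, Dep (W := fun _ => Prop) n (p j)) :
    Dep (W := fun _ => Prop) (n + 1) fun ω => p (ω.2 n) ω := by
  intro ω
  have h : (trunc (n + 1) ω).2 n = ω.2 n := by simp [trunc, truncSeq]
  change p _ _ = p _ _
  rw [h]
  exact (hp _).mono n.le_succ ω

/-- The `n`-th coordinate is generic over everything that depends on earlier coordinates only. -/
theorem eventually_limUltrafilter_diagonal {n : ℕ} {p : J → LimIndex J → Prop}
    (hp : ∀ j, Dep (W := fun _ => Prop) n (p j))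
    (h : ∀ᶠ j in D, ∀ᶠ ω in limUltrafilter D, p j ω) : ∀ᶠ ω in limUltrafilter D, p (ω.2 n) ω := by
  rw [eventually_limUltrafilter_iff (dep_succ_diagonal hp)]
  change ∀ᶠ j in D, ∀ᶠ ω in iterProd D n, p ((setCoord n j ω).2 n) (setCoord n j ω)
  refine h.mono fun j hj => ((eventually_limUltrafilter_iff (hp j)).1 hj).mono fun ω hω => ?_
  have : (setCoord n j ω).2 n = j := by simp [setCoord]
  rw [this, hp j, trunc_setCoord le_rfl, ← hp j]
  exact hω

end LimIndex

open LimIndex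

variable {J : Type u} [Nonempty J] (D : Ultrafilter J) (Z : J → Type u)

/-- A dependent function that depends on only finitely many coordinates. -/
def FinDep (W : J → Type v) : Type (max u v) := {x : ∀ ω : LimIndex J, W ω.1 // ∃ n, Dep n x}

/-- Equality almost everywhere of functions that depend on finitely many coordinates. -/
def limSetoid : Setoid (FinDep Z) where
  r x y := ∀ᶠ ω in limUltrafilter D, x.1 ω = y.1 ω
  iseqv := ⟨fun _ => .of_forall fun _ => rfl, fun h => h.mono fun _ => Eq.symm,
    fun h h' => (h.and h').mono fun _ h => h.1.trans h.2⟩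

/-- The limit ultraproduct of the factors `Z j`. -/
def LimProd : Type u := Quotient (limSetoid D Z)

variable {D Z}

/-- The element of the limit ultraproduct that a function represents. -/
def LimProd.mk (x : FinDep Z) : LimProd D Z := Quotient.mk (limSetoid D Z) x

theorem LimProd.exists_rep (q : LimProd D Z) : ∃ x : FinDep Z, LimProd.mk x = q :=
  Quotient.exists_rep q

theorem LimProd.mk_eq_mk {x y : FinDep Z} :
    (LimProd.mk x : LimProd D Z) = LimProd.mk y ↔ ∀ᶠ ω in limUltrafilter D, x.1 ω = y.1 ω :=
  Quotient.eq

variable (D) in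
/-- The internal set that a family of subsets of the factors represents. -/
def star (S : ∀ ω : LimIndex J, Set (Z ω.1)) : Set (LimProd D Z) :=
  {q | Quotient.liftOn q (fun x : FinDep Z => ∀ᶠ ω in limUltrafilter D, x.1 ω ∈ S ω) fun _ _ h =>
    propext (eventually_congr (Eventually.mono h fun ω hω => by rw [hω]))}

theorem mk_mem_star {S : ∀ ω : LimIndex J, Set (Z ω.1)} {x : FinDep Z} :
    LimProd.mk x ∈ star D S ↔ ∀ᶠ ω in limUltrafilter D, x.1 ω ∈ S ω := Iff.rfl

section

variable {S S' : ∀ ω : LimIndex J, Set (Z ω.1)}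

theorem star_compl : star D (fun ω => (S ω)ᶜ) = (star D S)ᶜ := by
  ext q
  obtain ⟨x, rfl⟩ := q.exists_rep
  exact Ultrafilter.eventually_not (f := limUltrafilter D) (p := fun ω => x.1 ω ∈ S ω)

theorem star_inter : star D (fun ω => S ω ∩ S' ω) = star D S ∩ star D S' := by
  ext q
  obtain ⟨x, rfl⟩ := q.exists_rep
  exact eventually_and (f := (limUltrafilter D : Filter _)) (p := fun ω => x.1 ω ∈ S ω)

theorem star_congr (h : ∀ᶠ ω in limUltrafilter D, S ω = S' ω) : star D S = star D S' := by
  ext q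
  obtain ⟨x, rfl⟩ := q.exists_rep
  rw [mk_mem_star, mk_mem_star]
  exact eventually_congr (h.mono fun ω hω => by rw [hω])

theorem star_mono (h : ∀ᶠ ω in limUltrafilter D, S ω ⊆ S' ω) : star D S ⊆ star D S' := by
  intro q
  obtain ⟨x, rfl⟩ := q.exists_rep
  exact fun hx => (mk_mem_star.1 hx).mp (h.mono fun ω hω hx => hω hx)

variable [∀ j, Nonempty (Z j)]

theorem star_nonempty {n : ℕ} (hS : Dep (W := fun j => Set (Z j)) n S) :
    (star D S).Nonempty ↔ ∀ᶠ ω in limUltrafilter D, (S ω).Nonempty := by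
  constructor
  · rintro ⟨q, hq⟩
    obtain ⟨x, rfl⟩ := q.exists_rep
    exact (mk_mem_star.1 hq).mono fun ω hω => ⟨_, hω⟩
  · intro h
    obtain ⟨x, hx, hxS⟩ := exists_dep_choice (W := Z) (n := n) (R := fun ω d => d ∈ S ω) fun ω => by
      funext d
      exact congrArg (d ∈ ·) (hS ω)
    exact ⟨LimProd.mk ⟨x, n, hx⟩, mk_mem_star.2 (h.mono hxS)⟩

theorem star_subset_star {n : ℕ} (hS : Dep (W := fun j => Set (Z j)) n S)
    (hS' : Dep (W := fun j => Set (Z j)) n S') :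
    star D S ⊆ star D S' ↔ ∀ᶠ ω in limUltrafilter D, S ω ⊆ S' ω := by
  refine ⟨fun h => ?_, star_mono⟩
  rw [← disjoint_compl_right_iff_subset, disjoint_iff_inter_eq_empty, ← star_compl, ← star_inter,
    ← not_nonempty_iff_eq_empty, star_nonempty (n := n), ← Ultrafilter.eventually_not] at h
  · refine h.mono fun ω hω => ?_
    rwa [← disjoint_compl_right_iff_subset, disjoint_iff_inter_eq_empty,
      ← not_nonempty_iff_eq_empty]
  · intro ω
    exact congrArg₂ (fun A B => A ∩ Bᶜ) (hS ω) (hS' ω)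

theorem star_eq_star {n : ℕ} (hS : Dep (W := fun j => Set (Z j)) n S)
    (hS' : Dep (W := fun j => Set (Z j)) n S') :
    star D S = star D S' ↔ ∀ᶠ ω in limUltrafilter D, S ω = S' ω := by
  simp only [Subset.antisymm_iff, star_subset_star hS hS', star_subset_star hS' hS, eventually_and]

instance : Nonempty (LimProd D Z) :=
  ⟨LimProd.mk ⟨fun ω => Classical.arbitrary (Z ω.1), 0, fun _ => rfl⟩⟩

end

/-! ### The topology of a limit ultraproduct -/

variable [∀ j, TopologicalSpace (Z j)]

variable (D Z) in
/-- The internal open sets. -/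
def internalOpens : Set (Set (LimProd D Z)) :=
  {O | ∃ (n : ℕ) (S : ∀ ω : LimIndex J, Set (Z ω.1)), Dep (W := fun j => Set (Z j)) n S ∧
    (∀ᶠ ω in limUltrafilter D, IsOpen (S ω)) ∧ star D S = O}

instance : TopologicalSpace (LimProd D Z) := .generateFrom (internalOpens D Z)

theorem univ_mem_internalOpens : univ ∈ internalOpens D Z := by
  refine ⟨0, fun _ => univ, fun _ => rfl, .of_forall fun _ => isOpen_univ, ?_⟩
  refine eq_univ_of_forall fun q => ?_
  obtain ⟨x, rfl⟩ := q.exists_rep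
  exact mk_mem_star.2 (.of_forall fun _ => trivial)

theorem isTopologicalBasis_internalOpens :
    TopologicalSpace.IsTopologicalBasis (internalOpens D Z) := by
  refine ⟨?_, sUnion_eq_univ_iff.2 fun q => ⟨_, univ_mem_internalOpens, trivial⟩, rfl⟩
  rintro _ ⟨n, S, hS, hSo, rfl⟩ _ ⟨m, S', hS', hSo', rfl⟩ q hq
  refine ⟨_, ⟨max n m, fun ω => S ω ∩ S' ω, fun ω => ?_,
    (hSo.and hSo').mono fun ω h => h.1.inter h.2, star_inter⟩, hq, Subset.rfl⟩
  exact congrArg₂ (· ∩ ·) (hS.mono (le_max_left n m) ω) (hS'.mono (le_max_right n m) ω)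

theorem interior_star [∀ j, Nonempty (Z j)] {n : ℕ} {S : ∀ ω : LimIndex J, Set (Z ω.1)}
    (hS : Dep (W := fun j => Set (Z j)) n S) :
    interior (star D S) = star D fun ω => interior (S ω) := by
  apply Subset.antisymm
  · intro q hq
    obtain ⟨_, ⟨m, U, hU, hUo, rfl⟩, hqU, hUS⟩ :=
      isTopologicalBasis_internalOpens.mem_nhds_iff.1 (mem_interior_iff_mem_nhds.1 hq)
    rw [star_subset_star (hU.mono (le_max_left m n)) (hS.mono (le_max_right m n))] at hUS
    exact star_mono ((hUo.and hUS).mono fun ω h => interior_maximal h.2 h.1) hqU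
  · refine interior_maximal (star_mono (.of_forall fun ω => interior_subset))
      (isTopologicalBasis_internalOpens.isOpen ⟨n, _, ?_, .of_forall fun _ => isOpen_interior, rfl⟩)
    exact fun ω => congrArg interior (hS ω)

namespace L2Formula

/-- **Łoś's theorem** for limit ultraproducts, with open variables ranging over the internal open
sets. The bound `n` is uniform in the variables, so that the truth set of a formula depends on
finitely many coordinates too, which is what the choice of a witness needs. -/
theorem sat_star_iff [∀ j, Nonempty (Z j)] {P : Type v} (φ : L2Formula P) (ν : ∀ j, P → Set (Z j))
    (n : ℕ) (g : ℕ → FinDep Z) (hg : ∀ k, Dep n (g k).1)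
    (G : ℕ → ∀ ω : LimIndex J, Set (Z ω.1)) (hG : ∀ k, Dep (W := fun j => Set (Z j)) n (G k)) :
    Sat (internalOpens D Z) (fun p => star D fun ω => ν ω.1 p) (fun k => LimProd.mk (g k))
        (fun k => star D (G k)) φ ↔
      ∀ᶠ ω in limUltrafilter D, Sat {O | IsOpen O} (ν ω.1) (fun k => (g k).1 ω) (fun k => G k ω) φ := by
  induction φ generalizing n g G with
  | verum => simp [Sat]
  | eqPt x y => exact LimProd.mk_eq_mk
  | eqOp U V => exact star_eq_star (hG U) (hG V)
  | pred p x => exact mk_mem_star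
  | mem x U => exact mk_mem_star
  | neg φ ih => exact (not_congr (ih n g hg G hG)).trans Ultrafilter.eventually_not.symm
  | and φ ψ ih₁ ih₂ =>
    exact (and_congr (ih₁ n g hg G hG) (ih₂ n g hg G hG)).trans eventually_and.symm
  | exPt x φ ih =>
    have key : ∀ (m : ℕ) (d : FinDep Z), Dep m d.1 →
        (Sat (internalOpens D Z) (fun p => star D fun ω => ν ω.1 p)
          (Function.update (fun k => LimProd.mk (g k)) x (LimProd.mk d)) (fun k => star D (G k)) φ ↔
        ∀ᶠ ω in limUltrafilter D, Sat {O | IsOpen O} (ν ω.1)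
          (Function.update (fun k => (g k).1 ω) x (d.1 ω)) (fun k => G k ω) φ) := by
      intro m d hd
      have h₁ : (fun k => (LimProd.mk (Function.update g x d k) : LimProd D Z)) =
          Function.update (fun k => LimProd.mk (g k)) x (LimProd.mk d) :=
        funext fun k => Function.apply_update (fun _ => LimProd.mk) g x d k
      have h₂ : ∀ ω, (fun k => (Function.update g x d k).1 ω) =
          Function.update (fun k => (g k).1 ω) x (d.1 ω) := fun ω =>
        funext fun k => Function.apply_update (fun _ (f : FinDep Z) => f.1 ω) g x d k
      have := ih (max n m) (Function.update g x d) (fun k => ?_) G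
        (fun k => (hG k).mono (le_max_left n m))
      · simpa only [h₁, h₂] using this
      · by_cases hk : k = x
        · subst hk
          rw [Function.update_self]
          exact hd.mono (le_max_right n m)
        · rw [Function.update_of_ne hk]
          exact (hg k).mono (le_max_left n m)
    constructor
    · rintro ⟨q, hq⟩
      obtain ⟨d, rfl⟩ := q.exists_rep
      obtain ⟨m, hm⟩ := d.2
      exact ((key m d hm).1 hq).mono fun ω hω => ⟨_, hω⟩
    · intro h
      obtain ⟨d, hd, hdR⟩ := exists_dep_choice (W := Z) (n := n) (R := fun ω d =>
          Sat {O | IsOpen O} (ν ω.1) (Function.update (fun k => (g k).1 ω) x d)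
            (fun k => G k ω) φ) fun ω => funext fun d =>
        congrArg₂ (fun g' G' => Sat {O | IsOpen O} (ν ω.1) (Function.update g' x d) G' φ)
          (funext fun k => hg k ω) (funext fun k => hG k ω)
      exact ⟨_, (key n ⟨d, n, hd⟩ hd).2 (h.mono hdR)⟩
  | exOp U φ ih =>
    have key : ∀ (m : ℕ) (S : ∀ ω : LimIndex J, Set (Z ω.1)),
        Dep (W := fun j => Set (Z j)) m S →
        (Sat (internalOpens D Z) (fun p => star D fun ω => ν ω.1 p)
          (fun k => LimProd.mk (g k)) (Function.update (fun k => star D (G k)) U (star D S)) φ ↔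
        ∀ᶠ ω in limUltrafilter D, Sat {O | IsOpen O} (ν ω.1)
          (fun k => (g k).1 ω) (Function.update (fun k => G k ω) U (S ω)) φ) := by
      intro m S hS
      have h₁ : (fun k => star D (Function.update G U S k)) =
          Function.update (fun k => star D (G k)) U (star D S) :=
        funext fun k => Function.apply_update (fun _ => star D) G U S k
      have h₂ : ∀ ω, (fun k => Function.update G U S k ω) =
          Function.update (fun k => G k ω) U (S ω) := fun ω =>
        funext fun k =>
          Function.apply_update (fun _ (f : ∀ ω : LimIndex J, Set (Z ω.1)) => f ω) G U S k
      have := ih (max n m) g (fun k => (hg k).mono (le_max_left n m)) (Function.update G U S)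
        (fun k => ?_)
      · simpa only [h₁, h₂] using this
      · by_cases hk : k = U
        · subst hk
          rw [Function.update_self]
          exact hS.mono (le_max_right n m)
        · rw [Function.update_of_ne hk]
          exact (hG k).mono (le_max_left n m)
    constructor
    · rintro ⟨_, ⟨m, S, hS, hSo, rfl⟩, h⟩
      exact (((key m S hS).1 h).and hSo).mono fun ω hω => ⟨S ω, hω.2, hω.1⟩
    · intro h
      obtain ⟨S, hS, hSR⟩ := exists_dep_choice (W := fun j => Set (Z j)) (n := n)
          (R := fun ω O => IsOpen O ∧ Sat {O | IsOpen O} (ν ω.1) (fun k => (g k).1 ω)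
            (Function.update (fun k => G k ω) U O) φ) fun ω => funext fun O =>
        congrArg₂ (fun g' G' => IsOpen O ∧
            Sat {O | IsOpen O} (ν ω.1) g' (Function.update G' U O) φ)
          (funext fun k => hg k ω) (funext fun k => hG k ω)
      have h' := h.mono fun ω hω => hSR ω hω
      exact ⟨_, ⟨n, S, hS, h'.mono fun ω hω => hω.1, rfl⟩,
        (key n S hS).2 (h'.mono fun ω hω => hω.2)⟩

end L2Formula

/-- An `L_t`-sentence that is true in all factors is true in the limit ultraproduct. -/
theorem L2Formula.TrueIn.limProd {J : Type u} [Nonempty J] {D : Ultrafilter J} {Z : J → Type u}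
    [∀ j, Nonempty (Z j)] [∀ j, TopologicalSpace (Z j)] {φ : L2Formula Empty} (hφ : φ.IsLt)
    (hs : φ.IsSentence) (h : ∀ j, φ.TrueIn (Z j)) : φ.TrueIn (LimProd D Z) := by
  intro g G _
  -- The assignment does not matter for a sentence; one by constant functions is convenient.
  let x : FinDep Z := ⟨fun ω => Classical.arbitrary (Z ω.1), 0, fun _ => rfl⟩
  rw [← hφ.sat_basis_iff isTopologicalBasis_internalOpens,
    L2Formula.sat_congr_free (g' := fun _ => LimProd.mk x)
      (G' := fun _ => star D fun ω : LimIndex J => (univ : Set (Z ω.1)))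
      (by simp [hs.1]) (by simp [hs.2])]
  have hν : (fun p : Empty => (p.elim : Set (LimProd D Z))) =
      fun p => star D fun ω : LimIndex J => (p.elim : Set (Z ω.1)) := funext fun p => p.elim
  rw [hν]
  refine (L2Formula.sat_star_iff φ (fun j p => p.elim) 0 (fun _ => x) (fun _ _ => rfl)
    (fun _ ω => univ) (fun _ _ => rfl)).2 (.of_forall fun ω => ?_)
  exact h ω.1 _ _ fun _ => isOpen_univ

/-! ### Saturation -/

section Saturation

variable {Y : Type u} {D : Ultrafilter (Finset (Set Y))} {Z : Finset (Set Y) → Type u}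
  [∀ j, Nonempty (Z j)] [∀ j, TopologicalSpace (Z j)] {P : ∀ j, Set Y → Set (Z j)}

variable (D P) in
/-- The internal set represented by the family of the sets `P j A`. -/
def starRep (A : Set Y) : Set (LimProd D Z) := star D fun ω : LimIndex _ => P ω.1 A

/-- The limit ultraproduct of finite representations is a total representation. -/
theorem isSetRep_starRep [TopologicalSpace Y]
    (hD : ∀ A : Set Y, ∀ᶠ j : Finset (Set Y) in D, A ∈ j) {N : ∀ j, Y → Z j}
    (h : ∀ j : Finset (Set Y), IsSetRep (j : Set (Set Y)) (P j) (N j)) :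
    IsSetRep univ (starRep D P)
      (fun y => LimProd.mk ⟨fun ω => N ω.1 y, 0, fun _ => rfl⟩ : Y → LimProd D Z) := by
  have hD' : ∀ A, ∀ᶠ ω : LimIndex (Finset (Set Y)) in limUltrafilter D, A ∈ ω.1 := fun A =>
    eventually_limUltrafilter_fst (hD A)
  refine ⟨fun A _ => ?_, fun A _ B _ => ?_, fun A _ => ?_, fun y _ => ?_⟩
  · rw [starRep, starRep, ← star_compl]
    exact star_congr ((hD' A).mono fun ω hω => (h ω.1).compl A hω)
  · rw [starRep, starRep, starRep, ← star_inter]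
    exact star_congr (((hD' A).and (hD' B)).mono fun ω hω => (h ω.1).inter A hω.1 B hω.2)
  · rw [starRep, starRep, interior_star (n := 0) fun _ => rfl]
    exact star_congr ((hD' A).mono fun ω hω => (h ω.1).interior A hω)
  · ext q
    obtain ⟨x, rfl⟩ := q.exists_rep
    refine (mk_mem_star.trans (eventually_congr ((hD' {y}).mono fun ω hω => ?_))).trans
      LimProd.mk_eq_mk.symm
    rw [(h ω.1).singleton y hω, mem_singleton_iff]

/-- Each subset of `Y` belongs to almost every finite set in the `n`-th coordinate. -/
theorem eventually_mem_coord (hD : ∀ A : Set Y, ∀ᶠ j : Finset (Set Y) in D, A ∈ j)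
    (n : ℕ) (A : Set Y) :
    ∀ᶠ ω : LimIndex (Finset (Set Y)) in limUltrafilter D, A ∈ ω.2 n :=
  eventually_limUltrafilter_diagonal (p := fun j _ => A ∈ j) (fun _ _ => rfl)
    ((hD A).mono fun _ h => .of_forall fun _ => h)

/-- The intersection of all the sets `starRep D P A` whose interior contains a given point is a
neighbourhood of this point. -/
theorem exists_isOpen_subset_starRep (hD : ∀ A : Set Y, ∀ᶠ j : Finset (Set Y) in D, A ∈ j)
    (q : LimProd D Z) :
    ∃ U, IsOpen U ∧ q ∈ U ∧ ∀ A, q ∈ interior (starRep D P A) → U ⊆ starRep D P A := by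
  obtain ⟨x, rfl⟩ := q.exists_rep
  obtain ⟨n, hx⟩ := x.2
  -- Almost every `ω.2 n` contains any given `A`, so intersecting over the members of the finite
  -- set `ω.2 n` deals with all `A` at once.
  let U : ∀ ω : LimIndex (Finset (Set Y)), Set (Z ω.1) := fun ω =>
    ⋂ A ∈ {A | A ∈ ω.2 n ∧ x.1 ω ∈ interior (P ω.1 A)}, interior (P ω.1 A)
  have hU : Dep (W := fun j => Set (Z j)) (n + 1) U := by
    intro ω
    have h₁ : (trunc (n + 1) ω).2 n = ω.2 n := by simp [trunc, truncSeq]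
    have h₂ : x.1 ω = x.1 (trunc (n + 1) ω) := hx.mono n.le_succ ω
    change (⋂ A ∈ {A | A ∈ ω.2 n ∧ x.1 ω ∈ interior (P ω.1 A)}, interior (P ω.1 A)) =
      ⋂ A ∈ {A | A ∈ (trunc (n + 1) ω).2 n ∧ x.1 (trunc (n + 1) ω) ∈ interior (P ω.1 A)},
        interior (P ω.1 A)
    rw [h₁, h₂]
    rfl
  refine ⟨star D U, isTopologicalBasis_internalOpens.isOpen
    ⟨n + 1, U, hU, .of_forall fun ω => ?_, rfl⟩, ?_, fun A hA => ?_⟩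
  · exact ((ω.2 n).finite_toSet.subset fun A hA => hA.1).isOpen_biInter fun A _ => isOpen_interior
  · exact mk_mem_star.2 (.of_forall fun ω => mem_iInter₂.2 fun A hA => hA.2)
  · rw [starRep, interior_star (n := 0) fun _ => rfl, mk_mem_star] at hA
    refine star_mono ((hA.and (eventually_mem_coord hD n A)).mono fun ω hω => ?_)
    exact fun d hd => interior_subset (mem_iInter₂.1 hd A ⟨hω.2, hω.1⟩)

/-- An ultrafilter whose members all meet an internal open set is realized in this set. -/
theorem exists_forall_mem_starRep (hD : ∀ A : Set Y, ∀ᶠ j : Finset (Set Y) in D, A ∈ j)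
    (hP : ∀ {A B : Set Y}, A ⊆ B → starRep D P A ⊆ starRep D P B)
    {U : Set (LimProd D Z)} (hU : U ∈ internalOpens D Z) (v : Ultrafilter Y)
    (hv : ∀ A ∈ v, (U ∩ starRep D P A).Nonempty) : ∃ q ∈ U, ∀ A ∈ v, q ∈ starRep D P A := by
  obtain ⟨n, S, hS, -, rfl⟩ := hU
  -- `R j` states the conditions from `v` that belong to the finite set `j`. Taking the generic `ω.2 n`
  -- for `j` includes every condition.
  let R : Finset (Set Y) → ∀ ω : LimIndex (Finset (Set Y)), Set (Z ω.1) := fun j ω =>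
    {d | d ∈ S ω ∧ ∀ A ∈ j, A ∈ v → d ∈ P ω.1 A}
  have hR : ∀ j, Dep (W := fun j => Set (Z j)) n (R j) := fun j ω =>
    congrArg (fun B : Set (Z ω.1) => {d | d ∈ B ∧ ∀ A ∈ j, A ∈ v → d ∈ P ω.1 A}) (hS ω)
  have hRe : ∀ j, ∀ᶠ ω in limUltrafilter D, (R j ω).Nonempty := by
    intro j
    have hB : ⋂ A ∈ {A | A ∈ j ∧ A ∈ v}, A ∈ v :=
      (biInter_mem (f := (v : Filter Y)) (j.finite_toSet.subset fun A hA => hA.1)).2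
        fun A hA => hA.2
    obtain ⟨q, hqS, hqB⟩ := hv _ hB
    obtain ⟨x, rfl⟩ := q.exists_rep
    have : ∀ᶠ ω in limUltrafilter D, ∀ A ∈ j, A ∈ v → x.1 ω ∈ P ω.1 A := by
      rw [eventually_all_finset]
      intro A hA
      by_cases hAv : A ∈ v
      · have := mk_mem_star.1 (hP (fun y hy => mem_iInter₂.1 hy A ⟨hA, hAv⟩) hqB)
        exact this.mono fun ω hω _ => hω
      · exact .of_forall fun ω h => absurd h hAv
    exact ((mk_mem_star.1 hqS).and this).mono fun ω hω => ⟨x.1 ω, hω⟩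
  have hne := eventually_limUltrafilter_diagonal (D := D) (n := n)
    (p := fun j ω => (R j ω).Nonempty)
    (fun j ω => congrArg (fun B : Set (Z ω.1) => B.Nonempty) (hR j ω)) (.of_forall hRe)
  obtain ⟨x, hx, hxR⟩ := exists_dep_choice (W := Z) (n := n + 1)
    (R := fun ω d => d ∈ R (ω.2 n) ω) (by
      intro ω
      have h₁ : (trunc (n + 1) ω).2 n = ω.2 n := by simp [trunc, truncSeq]
      funext d
      change (d ∈ R (ω.2 n) ω) = (d ∈ R ((trunc (n + 1) ω).2 n) (trunc (n + 1) ω))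
      rw [h₁]
      exact congrArg (fun B : Set (Z ω.1) => d ∈ B) ((hR _).mono n.le_succ ω))
  have hmem := hne.mono hxR
  refine ⟨LimProd.mk ⟨x, n + 1, hx⟩, mk_mem_star.2 (hmem.mono fun ω hω => hω.1), fun A hA => ?_⟩
  exact mk_mem_star.2 ((hmem.and (eventually_mem_coord hD n A)).mono
    fun ω hω => hω.1.2 A hω.2 hA)

end Saturation

end TopoModal

theorem theorem5p7 (K : TopoModal.SpaceClass.{u}) (hK : TopoModal.IsLtDefinable K) :
    TopoModal.IsHAtDefinable K ↔
      TopoModal.ClosedUnderUMorphicImages K ∧ TopoModal.ClosedUnderOpenSubspaces K := by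
  refine ⟨fun h => ⟨h.closedUnderUMorphicImages, h.closedUnderOpenSubspaces⟩, ?_⟩
  rintro ⟨hu, ho⟩
  obtain ⟨T, hT, hKT⟩ := hK
  refine ⟨{φ | ∀ (X : Type u) [TopologicalSpace X] [Nonempty X], K X → φ.Valid X},
    fun Y _ _ => ⟨fun hY φ hφ => hφ Y hY, fun hY => ?_⟩⟩
  -- The space in `K` that is mapped onto `Y*` is the limit ultraproduct of the `Z j`.
  choose Z _ _ P N hZ hrep using fun j : Finset (Set Y) =>
    TopoModal.exists_isSetRep_of_finite ho hY j.finite_toSet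
  let D : Ultrafilter (Finset (Set Y)) := Ultrafilter.of Filter.atTop
  have hD : ∀ A : Set Y, ∀ᶠ j : Finset (Set Y) in D, A ∈ j := fun A =>
    Ultrafilter.of_le Filter.atTop ((Filter.eventually_ge_atTop {A}).mono fun j hj =>
      Finset.singleton_subset_iff.1 hj)
  have h := TopoModal.isSetRep_starRep hD hrep
  refine hu (TopoModal.LimProd D Z) Y ((hKT _).2 fun φ hφ => ?_)
    (h.isUMorphicImage TopoModal.isTopologicalBasis_internalOpens
      TopoModal.univ_mem_internalOpens (TopoModal.exists_isOpen_subset_starRep hD)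
      fun U hU v => TopoModal.exists_forall_mem_starRep hD h.mono hU v)
  exact .limProd (hT φ hφ).1 (hT φ hφ).2 fun j => (hKT _).1 (hZ j) φ hφ
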